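/- Let $\mathbb{K}$ be a field, $V_1,\dots,V_n$ finite dimensional $\mathbb{K}$-vector spaces, and let $S=\mathrm{Sym}(V_1\oplus\cdots\oplus V_n)$, the total coordinate ring of $\mathbb{P}V_1\times\cdots\times\mathbb{P}V_n$, with its usual $\mathbb{Z}^n$-grading. For a graded $S$-module $M$ let $M(\underline{b})$ be the shifted module with $M(\underline{b})_{\underline{a}}=M_{\underline{a}+\underline{b}}$, and for a tuple $\underline{d}=(d_1,\dots,d_n)$ of positive integers let $K^{\underline{d}}_{p,q}(M)$ be the homology of the three-term Koszul complex $$\textstyle\bigwedge^{p+1}S_{\underline{d}}\otimes M_{(q-1)\underline{d}}\to\bigwedge^{p}S_{\underline{d}}\otimes M_{q\underline{d}}\to\bigwedge^{p-1}S_{\underline{d}}\otimes M_{(q+1)\underline{d}}.$$ For integers $q\ge 2$ and $\underline{b}\in\mathbb{Z}^n$ let $P_{q,\underline{b}}(\underline{d})$ be functions (with real values) such that, for every tuple $\underline{d}$ of positive integers and every $p\ge 0$ with $p\le P_{q,\underline{b}}(\underline{d})$, the syzygy functor $(V_1,\dots,V_n)\mapsto K^{\underline{d}}_{p,q}(S(\underline{b}))$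 vanishes identically, i.e. for all tuples of finite dimensional vector spaces. Let $q\ge 2$ be an integer and let $M$ be a finitely generated $\mathbb{Z}^n$-graded $S$-module with minimal graded free resolution $$0\leftarrow M\leftarrow E_0\leftarrow E_1\leftarrow\cdots\leftarrow E_m\leftarrow 0,\qquad E_i=\bigoplus_{\underline{b}\in\mathcal{S}_i}F_{i,\underline{b}}\otimes S(\underline{b}),$$ where the $F_{i,\underline{b}}$ are finite dimensional vector spaces and the $\mathcal{S}_i\subset\mathbb{Z}^n$ are finite sets. For every tuple $\underline{d}$ of positive integers put $$P(\underline{d})=\min\{P_{q+i,\underline{b}}(\underline{d})+i:\ \underline{b}\in\mathcal{S}_i,\ i=0,\dots,m\}$$ (with $P(\underline{d})=+\infty$ if all the $\mathcal{S}_i$ are empty). Then $K^{\underline{d}}_{p,q}(M)=0$ for all integers $p\ge 0$ with $p\le P(\underline{d})$. -/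

import Mathlib

open scoped TensorProduct

noncomputable section

namespace SegreVeronese

/-! ### The total coordinate ring -/

/-- The total coordinate ring `S = Sym (V₁ ⊕ ⋯ ⊕ Vₙ)` of `ℙV₁ × ⋯ × ℙVₙ`, where `Vᵢ` is the
vector space over `K` with basis `x_{i,1}, …, x_{i,rᵢ}`. -/
abbrev CoordRing (K : Type*) [Field K] {n : ℕ} (r : Fin n → ℕ) : Type _ :=
  MvPolynomial (Σ i : Fin n, Fin (r i)) K

/-- The `ℤⁿ`-degree of a variable: the variables from `Vᵢ` have degree the `i`-th unit vector. -/
def varDegree {n : ℕ} (r : Fin n → ℕ) (x : Σ i : Fin n, Fin (r i)) : Fin n → ℤ :=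
  Pi.single x.1 1

/-- The graded piece `S_a`, for `a ∈ ℤⁿ`. -/
abbrev ringPiece (K : Type*) [Field K] {n : ℕ} (r : Fin n → ℕ) (a : Fin n → ℤ) :
    Submodule K (CoordRing K r) :=
  MvPolynomial.weightedHomogeneousSubmodule K (varDegree r) a

/-! ### Graded modules -/

/-- `ℳ` is a `ℤⁿ`-grading of the `S`-module `M`: `M` is the direct sum of the `ℳ a`, and
`S_a · ℳ c ⊆ ℳ (a + c)`. -/
structure IsMultigrading {K : Type*} [Field K] {n : ℕ} (r : Fin n → ℕ)
    {M : Type*} [AddCommGroup M] [Module K M] [Module (CoordRing K r) M]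
    (ℳ : (Fin n → ℤ) → Submodule K M) : Prop where
  isInternal : DirectSum.IsInternal ℳ
  smul_mem : ∀ (a c : Fin n → ℤ) (s : CoordRing K r) (x : M),
    s ∈ ringPiece K r a → x ∈ ℳ c → s • x ∈ ℳ (a + c)

/-- The grading of the shifted module `M(b)`, that is `M(b)_a = M_{a + b}`. -/
def shift {K : Type*} [Field K] {n : ℕ} {M : Type*} [AddCommGroup M] [Module K M]
    (ℳ : (Fin n → ℤ) → Submodule K M) (b : Fin n → ℤ) : (Fin n → ℤ) → Submodule K M :=
  fun a => ℳ (a + b)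

theorem IsMultigrading.shift {K : Type*} [Field K] {n : ℕ} {r : Fin n → ℕ}
    {M : Type*} [AddCommGroup M] [Module K M] [Module (CoordRing K r) M]
    {ℳ : (Fin n → ℤ) → Submodule K M} (h : IsMultigrading r ℳ) (b : Fin n → ℤ) :
    IsMultigrading r (shift ℳ b) where
  isInternal := by
    have h1 := (DirectSum.isInternal_submodule_iff_iSupIndep_and_iSup_eq_top ℳ).1 h.isInternal
    refine (DirectSum.isInternal_submodule_iff_iSupIndep_and_iSup_eq_top _).2 ⟨?_, ?_⟩
    · exact h1.1.comp (add_left_injective b)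
    · rw [← h1.2]
      exact (Equiv.addRight b).iSup_comp (g := ℳ)
  smul_mem := by
    intro a c s x hs hx
    have := h.smul_mem a (c + b) s x hs hx
    rwa [← add_assoc] at this

theorem isMultigrading_ringPiece (K : Type*) [Field K] {n : ℕ} (r : Fin n → ℕ) :
    IsMultigrading r (ringPiece K r) where
  isInternal := by
    let := MvPolynomial.weightedGradedAlgebra K (varDegree r)
    exact DirectSum.Decomposition.isInternal (ringPiece K r)
  smul_mem := by
    intro a c s x hs hx
    exact MvPolynomial.IsWeightedHomogeneous.mul hs hx

/-! ### Koszul complexes and syzygy modules -/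

/-- For fixed `x`, the alternating map
`(w₀, …, w_p) ↦ ∑ᵢ (-1)ⁱ μ(wᵢ, x) ⊗ (w₀ ∧ ⋯ ŵᵢ ⋯ ∧ w_p)`. -/
def koszulAlt {K W A B : Type*} [CommRing K] [AddCommGroup W] [Module K W]
    [AddCommGroup A] [Module K A] [AddCommGroup B] [Module K B]
    (μ : W →ₗ[K] A →ₗ[K] B) (p : ℕ) (x : A) :
    W [⋀^Fin (p + 1)]→ₗ[K] B ⊗[K] (⋀[K]^p W) :=
  AlternatingMap.alternatizeUncurryFin
    { toFun := fun w => (TensorProduct.mk K B (⋀[K]^p W) (μ w x)).compAlternatingMap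
        (exteriorPower.ιMulti K p)
      map_add' := fun w w' => by
        ext v
        simp
      map_smul' := fun c w => by
        ext v
        simp [TensorProduct.smul_tmul'] }

/-- The Koszul differential `A ⊗ ⋀^{p+1} W → B ⊗ ⋀^p W` attached to a bilinear map
`μ : W × A → B`, that is
`x ⊗ (w₀ ∧ ⋯ ∧ w_p) ↦ ∑ᵢ (-1)ⁱ μ(wᵢ, x) ⊗ (w₀ ∧ ⋯ ŵᵢ ⋯ ∧ w_p)`. The tensor factors are written
with the exterior power on the right. -/
def koszulD {K W A B : Type*} [CommRing K] [AddCommGroup W] [Module K W]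
    [AddCommGroup A] [Module K A] [AddCommGroup B] [Module K B]
    (μ : W →ₗ[K] A →ₗ[K] B) (p : ℕ) :
    A ⊗[K] (⋀[K]^(p + 1) W) →ₗ[K] B ⊗[K] (⋀[K]^p W) :=
  TensorProduct.lift
    { toFun := fun x => exteriorPower.alternatingMapLinearEquiv (koszulAlt μ p x)
      map_add' := fun x y => by
        rw [← map_add]
        congr 1
        ext v
        simp [koszulAlt, AlternatingMap.alternatizeUncurryFin_apply,
          Finset.sum_add_distrib]
      map_smul' := fun c x => by
        rw [RingHom.id_apply, ← map_smul]
        congr 1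
        ext v
        simp [koszulAlt, AlternatingMap.alternatizeUncurryFin_apply, Finset.smul_sum,
          TensorProduct.smul_tmul', smul_comm c] }

theorem koszulD_ιMulti_tmul {K W A B : Type*} [CommRing K] [AddCommGroup W] [Module K W]
    [AddCommGroup A] [Module K A] [AddCommGroup B] [Module K B]
    (μ : W →ₗ[K] A →ₗ[K] B) (p : ℕ) (w : Fin (p + 1) → W) (x : A) :
    koszulD μ p (x ⊗ₜ[K] exteriorPower.ιMulti K (p + 1) w) =
      ∑ i : Fin (p + 1), (-1 : ℤ) ^ (i : ℕ) •
        (μ (w i) x ⊗ₜ[K] exteriorPower.ιMulti K p (i.removeNth w)) := by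
  simp [koszulD, koszulAlt, AlternatingMap.alternatizeUncurryFin_apply]

/-- The kernel of the Koszul differential leaving `A ⊗ ⋀^p W`; for `p = 0` the target
`B ⊗ ⋀^{-1} W` of the differential is zero. -/
def koszulCycles {K W A B : Type*} [CommRing K] [AddCommGroup W] [Module K W]
    [AddCommGroup A] [Module K A] [AddCommGroup B] [Module K B]
    (μ : W →ₗ[K] A →ₗ[K] B) : (p : ℕ) → Submodule K (A ⊗[K] (⋀[K]^p W))
  | 0 => ⊤
  | p + 1 => LinearMap.ker (koszulD μ p)

/-- The homology in the middle of
`A ⊗ ⋀^{p+1} W → B ⊗ ⋀^p W → C ⊗ ⋀^{p-1} W`, where the maps are the Koszul differentials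
attached to `μ : W × A → B` and `ν : W × B → C`. -/
abbrev KoszulHomology {K W A B C : Type*} [CommRing K] [AddCommGroup W] [Module K W]
    [AddCommGroup A] [Module K A] [AddCommGroup B] [Module K B] [AddCommGroup C] [Module K C]
    (μ : W →ₗ[K] A →ₗ[K] B) (ν : W →ₗ[K] B →ₗ[K] C) (p : ℕ) : Type _ :=
  koszulCycles ν p ⧸ (LinearMap.range (koszulD μ p)).submoduleOf (koszulCycles ν p)

theorem subsingleton_koszulHomology_iff {K W A B C : Type*} [CommRing K]
    [AddCommGroup W] [Module K W] [AddCommGroup A] [Module K A] [AddCommGroup B] [Module K B]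
    [AddCommGroup C] [Module K C]
    (μ : W →ₗ[K] A →ₗ[K] B) (ν : W →ₗ[K] B →ₗ[K] C) (p : ℕ) :
    Subsingleton (KoszulHomology μ ν p) ↔ koszulCycles ν p ≤ LinearMap.range (koszulD μ p) := by
  rw [Submodule.Quotient.subsingleton_iff, Submodule.submoduleOf_eq_top]

/-- The multiplication `S_d × M_a → M_c`, where `c = d + a`. -/
def gradedMul {K : Type*} [Field K] {n : ℕ} {r : Fin n → ℕ}
    {M : Type*} [AddCommGroup M] [Module K M] [Module (CoordRing K r) M]
    [IsScalarTower K (CoordRing K r) M]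
    {ℳ : (Fin n → ℤ) → Submodule K M} (h : IsMultigrading r ℳ)
    (d a c : Fin n → ℤ) (hc : d + a = c) :
    ringPiece K r d →ₗ[K] ℳ a →ₗ[K] ℳ c :=
  LinearMap.mk₂ K
    (fun s x => ⟨(s : CoordRing K r) • (x : M), hc ▸ h.smul_mem d a s x s.2 x.2⟩)
    (fun _ _ _ => Subtype.ext (add_smul _ _ _))
    (fun _ _ _ => Subtype.ext (smul_assoc _ _ _))
    (fun _ _ _ => Subtype.ext (smul_add _ _ _))
    (fun _ _ _ => Subtype.ext (smul_algebra_smul_comm _ _ _))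

/-- The `d`-syzygy module `K^d_{p,q}(M)`, the homology in the middle of
`M_{(q-1)d} ⊗ ⋀^{p+1} S_d → M_{qd} ⊗ ⋀^p S_d → M_{(q+1)d} ⊗ ⋀^{p-1} S_d`. -/
abbrev Syzygy {K : Type*} [Field K] {n : ℕ} {r : Fin n → ℕ}
    {M : Type*} [AddCommGroup M] [Module K M] [Module (CoordRing K r) M]
    [IsScalarTower K (CoordRing K r) M]
    {ℳ : (Fin n → ℤ) → Submodule K M} (h : IsMultigrading r ℳ)
    (d : Fin n → ℤ) (p : ℕ) (q : ℤ) : Type _ :=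
  KoszulHomology
    (gradedMul h d ((q - 1) • d) (q • d) (by module))
    (gradedMul h d (q • d) ((q + 1) • d) (by module)) p

/-- The value `K^d_{p,q}(b)(V₁, …, Vₙ) = K^d_{p,q}(S(b))` of a syzygy functor at the vector
spaces `Vᵢ` of dimension `rᵢ`: the Koszul cohomology of the line bundle `𝒪(b)` on
`ℙV₁ × ⋯ × ℙVₙ` with respect to `𝒪(d)`. -/
abbrev SyzygyFunctor (K : Type*) [Field K] {n : ℕ} (d : Fin n → ℤ) (p : ℕ) (q : ℤ)
    (b : Fin n → ℤ) (r : Fin n → ℕ) : Type _ :=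
  Syzygy ((isMultigrading_ringPiece K r).shift b) d p q

/-- `P q b d` is a family of functions `P_{q,b}(d)` such that, for all `q ≥ 2`, all `b ∈ ℤⁿ` and
all tuples `d` of positive integers, the functor `K^d_{p,q}(b)` vanishes identically
for `p ≤ P_{q,b}(d)`. -/
def IsVanishingBound (K : Type*) [Field K] {n : ℕ}
    (P : ℤ → (Fin n → ℤ) → (Fin n → ℤ) → ℝ) : Prop :=
  ∀ q : ℤ, 2 ≤ q → ∀ b d : Fin n → ℤ, (∀ i, 0 < d i) →
    ∀ p : ℕ, (p : ℝ) ≤ P q b d → ∀ r : Fin n → ℕ, Subsingleton (SyzygyFunctor K d p q b r)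

/-! ### Graded free resolutions -/

/-- The free module `⨁_{b ∈ B} F_b ⊗ S(b)` with `F_b = K ^ f b`. -/
abbrev FreeMod (K : Type*) [Field K] {n : ℕ} (r : Fin n → ℕ)
    (B : Finset (Fin n → ℤ)) (f : (Fin n → ℤ) → ℕ) : Type _ :=
  (Σ b : B, Fin (f b)) → CoordRing K r

/-- The graded piece of degree `a` of `⨁_{b ∈ B} F_b ⊗ S(b)`, namely `⨁_{b ∈ B} F_b ⊗ S_{a+b}`. -/
def freePiece (K : Type*) [Field K] {n : ℕ} (r : Fin n → ℕ)
    (B : Finset (Fin n → ℤ)) (f : (Fin n → ℤ) → ℕ) (a : Fin n → ℤ) :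
    Submodule K (FreeMod K r B f) :=
  Submodule.pi Set.univ fun k => shift (ringPiece K r) (k.1 : Fin n → ℤ) a

/-- A finite graded free resolution
`0 ← M ← E₀ ← E₁ ← ⋯ ← E_m ← 0` with `E_i = ⨁_{b ∈ 𝒮_i} F_{i,b} ⊗ S(b)`,
`𝒮_i ⊂ ℤⁿ` finite and `F_{i,b} = K ^ rank i b`. -/
structure FreeResolution {K : Type*} [Field K] {n : ℕ} (r : Fin n → ℕ)
    {M : Type*} [AddCommGroup M] [Module K M] [Module (CoordRing K r) M]
    (ℳ : (Fin n → ℤ) → Submodule K M) where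
  /-- the length `m` -/
  length : ℕ
  /-- the finite sets `𝒮_i` -/
  twists : ℕ → Finset (Fin n → ℤ)
  /-- the dimensions of the vector spaces `F_{i,b}` -/
  rank : ℕ → (Fin n → ℤ) → ℕ
  /-- the map `E₀ → M` -/
  aug : FreeMod K r (twists 0) (rank 0) →ₗ[CoordRing K r] M
  /-- the map `E_{i+1} → E_i` -/
  diff : ∀ i, FreeMod K r (twists (i + 1)) (rank (i + 1)) →ₗ[CoordRing K r]
    FreeMod K r (twists i) (rank i)
  twists_eq_empty : ∀ i, length < i → twists i = ∅
  aug_mem : ∀ a, ∀ x ∈ freePiece K r (twists 0) (rank 0) a, aug x ∈ ℳ a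
  diff_mem : ∀ i a, ∀ x ∈ freePiece K r (twists (i + 1)) (rank (i + 1)) a,
    diff i x ∈ freePiece K r (twists i) (rank i) a
  aug_surjective : Function.Surjective aug
  exact_zero : LinearMap.range (diff 0) = LinearMap.ker aug
  exact_succ : ∀ i, LinearMap.range (diff (i + 1)) = LinearMap.ker (diff i)

/-- The resolution is minimal: the image of each `E_{i+1} → E_i` lies in `𝔪 E_i`, where `𝔪 ⊂ S`
is the ideal generated by all the variables. -/
def FreeResolution.IsMinimal {K : Type*} [Field K] {n : ℕ} {r : Fin n → ℕ}
    {M : Type*} [AddCommGroup M] [Module K M] [Module (CoordRing K r) M]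
    {ℳ : (Fin n → ℤ) → Submodule K M} (E : FreeResolution r ℳ) : Prop :=
  ∀ i, LinearMap.range (E.diff i) ≤
    Ideal.span (Set.range (MvPolynomial.X : (Σ i : Fin n, Fin (r i)) → CoordRing K r)) •
      (⊤ : Submodule (CoordRing K r) (FreeMod K r (E.twists i) (E.rank i)))

/-- `min {P_{q+i,b}(d) + i : b ∈ 𝒮_i, i = 0, …, m}`, a minimum over a finite set, which is `⊤`
if all the sets `𝒮_i` are empty (so that `M = 0`). -/
def FreeResolution.minBound {K : Type*} [Field K] {n : ℕ} {r : Fin n → ℕ}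
    {M : Type*} [AddCommGroup M] [Module K M] [Module (CoordRing K r) M]
    {ℳ : (Fin n → ℤ) → Submodule K M} (E : FreeResolution r ℳ)
    (P : ℤ → (Fin n → ℤ) → (Fin n → ℤ) → ℝ) (q : ℤ) (d : Fin n → ℤ) : WithTop ℝ :=
  (Finset.range (E.length + 1)).inf fun i =>
    (E.twists i).inf fun b => ((P (q + i) b d + i : ℝ) : WithTop ℝ)

end SegreVeronese

end

noncomputable section

namespace SegreVeronese

/-! ### Functoriality of Koszul complexes -/

section Koszul

variable {K W : Type*} [CommRing K] [AddCommGroup W] [Module K W]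
  {A B C A' B' C' : Type*} [AddCommGroup A] [Module K A] [AddCommGroup B] [Module K B]
  [AddCommGroup C] [Module K C] [AddCommGroup A'] [Module K A'] [AddCommGroup B'] [Module K B']
  [AddCommGroup C'] [Module K C']

/-! The proof is dimension shifting along the resolution. Put `Z₀ = M` and let `Z_i` be the `i`-th
syzygy module, so that `0 → Z_{i+1} → E_i → Z_i → 0` is exact. The long exact sequence of Koszul
homology contains `K_{p,q}(E_i) → K_{p,q}(Z_i) → K_{p-1,q+1}(Z_{i+1})`. Hence `K_{p,q}(M) = 0` once
`K_{p-j,q+j}(E_j) = 0` for `0 ≤ j ≤ p`. Each `E_j` is a finite sum of modules `S(b)`, and `p ≤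
P_{q+j,b}(d) + j` is exactly what makes their syzygies vanish.

The modules `Z_i` are never formed: `KernelKoszulExact` states the vanishing for the kernel of a map
by elements of the ambient complex. This is legitimate because exterior powers over a field are
flat. `KernelKoszulExact.succ` is the diagram chase, `exact_pieceMap` gives exactness degree by
degree, and `FreeResolution.subsingleton_syzygy` collects the result. -/

theorem koszulD_comp_koszulD {μ : W →ₗ[K] A →ₗ[K] B} {ν : W →ₗ[K] B →ₗ[K] C}
    (h : ∀ w w' x, ν w (μ w' x) = ν w' (μ w x)) (p : ℕ) (z : A ⊗[K] (⋀[K]^(p + 2) W)) :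
    koszulD ν p (koszulD μ (p + 1) z) = 0 := by
  suffices H : koszulD ν p ∘ₗ koszulD μ (p + 1) = 0 from LinearMap.congr_fun H z
  apply TensorProduct.ext
  ext1 x
  apply exteriorPower.linearMap_ext
  -- Two contractions alternatize the family `f` twice; by `h` it is symmetric in its two arguments,
  -- so terms cancel in pairs.
  let f : W →ₗ[K] W →ₗ[K] W [⋀^Fin p]→ₗ[K] C ⊗[K] (⋀[K]^p W) :=
    LinearMap.mk₂ K
      (fun w w' => (TensorProduct.mk K C (⋀[K]^p W) (ν w' (μ w x))).compAlternatingMap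
        (exteriorPower.ιMulti K p))
      (fun _ _ _ => by ext; simp) (fun _ _ _ => by ext; simp [TensorProduct.smul_tmul'])
      (fun _ _ _ => by ext; simp) (fun _ _ _ => by ext; simp [TensorProduct.smul_tmul'])
  have hf := AlternatingMap.alternatizeUncurryFin_alternatizeUncurryFinLM_comp_of_symmetric
    (f := f) (fun w w' => by ext v; simp [f, h w w'])
  ext v
  have hv := congrArg (fun g => g v) hf
  simpa [koszulD_ιMulti_tmul, AlternatingMap.alternatizeUncurryFin_apply, f] using hv

/-- Naturality of the Koszul differential. -/
theorem koszulD_rTensor {μ : W →ₗ[K] A →ₗ[K] B} {μ' : W →ₗ[K] A' →ₗ[K] B'}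
    {f : A →ₗ[K] A'} {g : B →ₗ[K] B'} (h : ∀ w x, g (μ w x) = μ' w (f x)) (p : ℕ)
    (z : A ⊗[K] (⋀[K]^(p + 1) W)) :
    koszulD μ' p (f.rTensor _ z) = g.rTensor _ (koszulD μ p z) := by
  suffices H : koszulD μ' p ∘ₗ f.rTensor _ = g.rTensor _ ∘ₗ koszulD μ p from
    LinearMap.congr_fun H z
  apply TensorProduct.ext
  ext1 x
  apply exteriorPower.linearMap_ext
  ext v
  simp [koszulD_ιMulti_tmul, h]

theorem rTensor_mem_koszulCycles {ν : W →ₗ[K] B →ₗ[K] C} {ν' : W →ₗ[K] B' →ₗ[K] C'}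
    {g : B →ₗ[K] B'} {k : C →ₗ[K] C'} (h : ∀ w x, k (ν w x) = ν' w (g x)) (p : ℕ)
    {y : B ⊗[K] (⋀[K]^p W)} (hy : y ∈ koszulCycles ν p) :
    g.rTensor _ y ∈ koszulCycles ν' p := by
  cases p with
  | zero => trivial
  | succ p =>
    have hy' : koszulD ν p y = 0 := hy
    change koszulD ν' p _ = 0
    rw [koszulD_rTensor h, hy', map_zero]

/-- If a Koszul complex is a direct sum of exact ones then it is exact. -/
theorem koszulCycles_le_range_of_sum {ι : Type*} [Fintype ι]
    {A' B' C' : ι → Type*} [∀ i, AddCommGroup (A' i)] [∀ i, Module K (A' i)]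
    [∀ i, AddCommGroup (B' i)] [∀ i, Module K (B' i)]
    [∀ i, AddCommGroup (C' i)] [∀ i, Module K (C' i)]
    {μ : W →ₗ[K] A →ₗ[K] B} {ν : W →ₗ[K] B →ₗ[K] C}
    {μ' : ∀ i, W →ₗ[K] A' i →ₗ[K] B' i} {ν' : ∀ i, W →ₗ[K] B' i →ₗ[K] C' i}
    {jA : ∀ i, A' i →ₗ[K] A} {jB : ∀ i, B' i →ₗ[K] B}
    {πB : ∀ i, B →ₗ[K] B' i} {πC : ∀ i, C →ₗ[K] C' i}
    (hj : ∀ i w x, jB i (μ' i w x) = μ w (jA i x))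
    (hπ : ∀ i w x, πC i (ν w x) = ν' i w (πB i x))
    (hid : ∑ i, jB i ∘ₗ πB i = LinearMap.id) (p : ℕ)
    (h : ∀ i, koszulCycles (ν' i) p ≤ LinearMap.range (koszulD (μ' i) p)) :
    koszulCycles ν p ≤ LinearMap.range (koszulD μ p) := by
  intro y hy
  -- Project the cycle to each summand, bound it there and add up the images; only the middle term
  -- has to be decomposed, by `hid`.
  choose z hz using fun i => h i (rTensor_mem_koszulCycles (hπ i) p hy)
  refine ⟨∑ i, (jA i).rTensor _ (z i), ?_⟩
  have hsum : (∑ i, jB i ∘ₗ πB i).rTensor (⋀[K]^p W) y = y := by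
    rw [hid, LinearMap.rTensor_id, LinearMap.id_apply]
  rw [map_sum]
  simp_rw [koszulD_rTensor (hj _), hz]
  conv_rhs => rw [← hsum]
  rw [← LinearMap.coe_rTensorHom, map_sum, LinearMap.sum_apply]
  simp [LinearMap.rTensor_comp]

/-- Every Koszul cycle of `(A, B, C)` killed by `gB` is a boundary of an element killed by `gA`:
the Koszul homology of the kernel of `g` vanishes. -/
def KernelKoszulExact (μ : W →ₗ[K] A →ₗ[K] B) (ν : W →ₗ[K] B →ₗ[K] C)
    (gA : A →ₗ[K] A') (gB : B →ₗ[K] B') (p : ℕ) : Prop :=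
  ∀ y ∈ koszulCycles ν p, gB.rTensor _ y = 0 →
    ∃ z, gA.rTensor _ z = 0 ∧ koszulD μ p z = y

variable {A'' B'' : Type*} [AddCommGroup A''] [Module K A''] [AddCommGroup B''] [Module K B'']

/-- For `p = 0` there is no cycle condition, so any lift of `y` along `fB` is already a boundary and
no connecting map intervenes. -/
theorem KernelKoszulExact.zero [Module.Flat K (⋀[K]^0 W)]
    {μ : W →ₗ[K] A →ₗ[K] B} {ν : W →ₗ[K] B →ₗ[K] C}
    {μ' : W →ₗ[K] A' →ₗ[K] B'} {ν' : W →ₗ[K] B' →ₗ[K] C'}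
    {fA : A →ₗ[K] A'} {fB : B →ₗ[K] B'} {gA : A' →ₗ[K] A''} {gB : B' →ₗ[K] B''}
    (hμ : ∀ w x, fB (μ w x) = μ' w (fA x))
    (hgA : gA ∘ₗ fA = 0) (hB : Function.Exact fB gB)
    (h : koszulCycles ν 0 ≤ LinearMap.range (koszulD μ 0)) :
    KernelKoszulExact μ' ν' gA gB 0 := by
  intro y _ hgy
  obtain ⟨y', rfl⟩ := (Module.Flat.rTensor_exact _ hB y).1 hgy
  obtain ⟨w, rfl⟩ := h (show y' ∈ koszulCycles ν 0 from trivial)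
  refine ⟨fA.rTensor _ w, ?_, koszulD_rTensor hμ 0 w⟩
  rw [← LinearMap.comp_apply, ← LinearMap.rTensor_comp, hgA, LinearMap.rTensor_zero,
    LinearMap.zero_apply]

/-- The step in the long exact sequence of Koszul homology for `0 → ker f → X → ker g → 0`. -/
theorem KernelKoszulExact.succ {p : ℕ} [Module.Flat K (⋀[K]^(p + 1) W)]
    {D : Type*} [AddCommGroup D] [Module K D]
    {μ : W →ₗ[K] A →ₗ[K] B} {ν : W →ₗ[K] B →ₗ[K] C} {ξ : W →ₗ[K] C →ₗ[K] D}
    {μ' : W →ₗ[K] A' →ₗ[K] B'} {ν' : W →ₗ[K] B' →ₗ[K] C'}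
    {fA : A →ₗ[K] A'} {fB : B →ₗ[K] B'} {fC : C →ₗ[K] C'} {gA : A' →ₗ[K] A''} {gB : B' →ₗ[K] B''}
    (hcomm : ∀ w w' x, ξ w (ν w' x) = ξ w' (ν w x))
    (hμ : ∀ w x, fB (μ w x) = μ' w (fA x)) (hν : ∀ w x, fC (ν w x) = ν' w (fB x))
    (hgA : gA ∘ₗ fA = 0) (hB : Function.Exact fB gB)
    (h : koszulCycles ν (p + 1) ≤ LinearMap.range (koszulD μ (p + 1)))
    (hker : KernelKoszulExact ν ξ fB fC p) :
    KernelKoszulExact μ' ν' gA gB (p + 1) := by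
  intro y hy hgy
  obtain ⟨y', rfl⟩ := (Module.Flat.rTensor_exact _ hB y).1 hgy
  have hy' : koszulD ν' p (fB.rTensor _ y') = 0 := hy
  rw [koszulD_rTensor hν] at hy'
  -- The differential of the lift `y'` represents the connecting class of `y` in the homology of the
  -- kernel of `f`, with `p` lowered by one.
  have hcyc : koszulD ν p y' ∈ koszulCycles ξ p := by
    cases p with
    | zero => trivial
    | succ p => exact koszulD_comp_koszulD hcomm p y'
  obtain ⟨z, hz, hzy⟩ := hker _ hcyc hy'
  -- Since `z` has the same differential as `y'` and dies under `fB`, the difference `y' - z` is a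
  -- cycle that still lifts `y`.
  obtain ⟨w, hw⟩ := h (show y' - z ∈ koszulCycles ν (p + 1) by
    change koszulD ν p (y' - z) = 0
    rw [map_sub, hzy, sub_self])
  refine ⟨fA.rTensor _ w, ?_, ?_⟩
  · rw [← LinearMap.comp_apply, ← LinearMap.rTensor_comp, hgA, LinearMap.rTensor_zero,
      LinearMap.zero_apply]
  · rw [koszulD_rTensor hμ, hw, map_sub, hz, sub_zero]

end Koszul

/-! ### Maps of graded modules -/

theorem IsMultigrading.iSup_eq_top {K : Type*} [Field K] {n : ℕ} {r : Fin n → ℕ}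
    {U : Type*} [AddCommGroup U] [Module K U] [Module (CoordRing K r) U]
    {𝒰 : (Fin n → ℤ) → Submodule K U} (hU : IsMultigrading r 𝒰) : iSup 𝒰 = ⊤ :=
  hU.isInternal.submodule_iSup_eq_top

theorem IsMultigrading.iSupIndep {K : Type*} [Field K] {n : ℕ} {r : Fin n → ℕ}
    {U : Type*} [AddCommGroup U] [Module K U] [Module (CoordRing K r) U]
    {𝒰 : (Fin n → ℤ) → Submodule K U} (hU : IsMultigrading r 𝒰) : iSupIndep 𝒰 :=
  hU.isInternal.submodule_iSupIndep

section Graded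

variable {K : Type*} [Field K] {n : ℕ} {r : Fin n → ℕ}
  {U V T : Type*} [AddCommGroup U] [Module K U] [Module (CoordRing K r) U]
  [IsScalarTower K (CoordRing K r) U]
  [AddCommGroup V] [Module K V] [Module (CoordRing K r) V] [IsScalarTower K (CoordRing K r) V]
  [AddCommGroup T] [Module K T] [Module (CoordRing K r) T] [IsScalarTower K (CoordRing K r) T]
  {𝒰 : (Fin n → ℤ) → Submodule K U} {𝒱 : (Fin n → ℤ) → Submodule K V}
  {𝒯 : (Fin n → ℤ) → Submodule K T}

/-- The map in degree `a` of a graded homomorphism. -/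
def pieceMap (f : U →ₗ[CoordRing K r] V) (hf : ∀ a, ∀ x ∈ 𝒰 a, f x ∈ 𝒱 a) (a : Fin n → ℤ) :
    𝒰 a →ₗ[K] 𝒱 a :=
  (f.restrictScalars K).restrict (hf a)

@[simp]
theorem coe_pieceMap (f : U →ₗ[CoordRing K r] V) (hf : ∀ a, ∀ x ∈ 𝒰 a, f x ∈ 𝒱 a)
    (a : Fin n → ℤ) (x : 𝒰 a) : (pieceMap f hf a x : V) = f x := rfl

@[simp]
theorem coe_gradedMul (hU : IsMultigrading r 𝒰) (d a c : Fin n → ℤ) (hc : d + a = c)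
    (s : ringPiece K r d) (x : 𝒰 a) :
    (gradedMul hU d a c hc s x : U) = (s : CoordRing K r) • (x : U) := rfl

theorem pieceMap_gradedMul (hU : IsMultigrading r 𝒰) (hV : IsMultigrading r 𝒱)
    (f : U →ₗ[CoordRing K r] V) (hf : ∀ a, ∀ x ∈ 𝒰 a, f x ∈ 𝒱 a)
    (d a c : Fin n → ℤ) (hc : d + a = c) (s : ringPiece K r d) (x : 𝒰 a) :
    pieceMap f hf c (gradedMul hU d a c hc s x) = gradedMul hV d a c hc s (pieceMap f hf a x) :=
  Subtype.ext (by simp)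

theorem gradedMul_comm (hU : IsMultigrading r 𝒰) (d a b c : Fin n → ℤ) (hb : d + a = b)
    (hc : d + b = c) (s t : ringPiece K r d) (x : 𝒰 a) :
    gradedMul hU d b c hc s (gradedMul hU d a b hb t x) =
      gradedMul hU d b c hc t (gradedMul hU d a b hb s x) :=
  Subtype.ext (by simp [smul_smul, mul_comm])

/-- Drop from `u` all components of degree other than `b`: their image lies in `𝒱 b` and in the sum
of the other pieces, hence is zero. -/
theorem exists_mem_piece_map_eq {f : U →ₗ[K] V} (hf : ∀ a, ∀ x ∈ 𝒰 a, f x ∈ 𝒱 a)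
    (hU : iSup 𝒰 = ⊤) (hV : iSupIndep 𝒱) {b : Fin n → ℤ} {u : U} (hu : f u ∈ 𝒱 b) :
    ∃ u' ∈ 𝒰 b, f u' = f u := by
  have hle : iSup 𝒰 ≤ 𝒰 b ⊔ ⨆ (a) (_ : a ≠ b), 𝒰 a := by
    refine iSup_le fun a => ?_
    by_cases hab : a = b
    · subst hab
      exact le_sup_left
    · exact le_sup_of_le_right (le_iSup₂_of_le a hab le_rfl)
  obtain ⟨u₁, hu₁, u₂, hu₂, rfl⟩ := Submodule.mem_sup.1
    (hle (by rw [hU]; trivial : u ∈ iSup 𝒰))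
  refine ⟨u₁, hu₁, ?_⟩
  have h₁ : f u₂ ∈ 𝒱 b := by simpa using sub_mem hu (hf b _ hu₁)
  have h₂ : (⨆ (a) (_ : a ≠ b), 𝒰 a) ≤ (⨆ (a) (_ : a ≠ b), 𝒱 a).comap f :=
    iSup₂_le fun a ha x hx => Submodule.mem_iSup_of_mem a
      (Submodule.mem_iSup_of_mem ha (hf a x hx))
  rw [map_add, Submodule.disjoint_def.1 (hV b) _ h₁ (h₂ hu₂), add_zero]

theorem exact_pieceMap (hU : IsMultigrading r 𝒰) (hV : IsMultigrading r 𝒱)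
    {f : U →ₗ[CoordRing K r] V} {g : V →ₗ[CoordRing K r] T}
    (hf : ∀ a, ∀ x ∈ 𝒰 a, f x ∈ 𝒱 a) (hg : ∀ a, ∀ x ∈ 𝒱 a, g x ∈ 𝒯 a)
    (h : LinearMap.range f = LinearMap.ker g) (a : Fin n → ℤ) :
    Function.Exact (pieceMap f hf a) (pieceMap g hg a) := by
  intro y
  constructor
  · intro hy
    have hy' : (y : V) ∈ LinearMap.ker g := congrArg Subtype.val hy
    rw [← h] at hy'
    obtain ⟨u, hu⟩ := hy'
    obtain ⟨u', hu', huu⟩ := exists_mem_piece_map_eq (f := f.restrictScalars K) hf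
      hU.iSup_eq_top hV.iSupIndep (u := u) (b := a) (by simp [hu])
    exact ⟨⟨u', hu'⟩, Subtype.ext (huu.trans hu)⟩
  · rintro ⟨x, rfl⟩
    exact Subtype.ext (show f x ∈ LinearMap.ker g from h ▸ ⟨x, rfl⟩)

theorem pieceMap_comp_eq_zero {f : U →ₗ[CoordRing K r] V} {g : V →ₗ[CoordRing K r] T}
    (hf : ∀ a, ∀ x ∈ 𝒰 a, f x ∈ 𝒱 a) (hg : ∀ a, ∀ x ∈ 𝒱 a, g x ∈ 𝒯 a)
    (h : LinearMap.range f = LinearMap.ker g) (a : Fin n → ℤ) :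
    pieceMap g hg a ∘ₗ pieceMap f hf a = 0 := by
  ext x
  exact show f x ∈ LinearMap.ker g from h ▸ ⟨x, rfl⟩

/-- `KernelKoszulExact` for the `d`-strand of a graded homomorphism `g`: the vanishing of
`K^d_{p,q}(ker g)`. -/
def KernelSyzygyVanishes (hV : IsMultigrading r 𝒱) (g : V →ₗ[CoordRing K r] T)
    (hg : ∀ a, ∀ x ∈ 𝒱 a, g x ∈ 𝒯 a) (d : Fin n → ℤ) (p : ℕ) (q : ℤ) : Prop :=
  KernelKoszulExact
    (gradedMul hV d ((q - 1) • d) (q • d) (by module))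
    (gradedMul hV d (q • d) ((q + 1) • d) (by module))
    (pieceMap g hg ((q - 1) • d)) (pieceMap g hg (q • d)) p

/-- If `U → V → T` is exact, `K_{p,q}(U) = 0` and `K_{p-1,q+1}` of the kernel of `U → V` vanishes,
then `K_{p,q}` of the kernel of `V → T` vanishes. -/
theorem kernelSyzygyVanishes_of_exact (hU : IsMultigrading r 𝒰) (hV : IsMultigrading r 𝒱)
    {f : U →ₗ[CoordRing K r] V} {g : V →ₗ[CoordRing K r] T}
    (hf : ∀ a, ∀ x ∈ 𝒰 a, f x ∈ 𝒱 a) (hg : ∀ a, ∀ x ∈ 𝒱 a, g x ∈ 𝒯 a)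
    (h : LinearMap.range f = LinearMap.ker g) (d : Fin n → ℤ) (p : ℕ) (q : ℤ)
    (hvan : Subsingleton (Syzygy hU d p q))
    (hker : ∀ p', p = p' + 1 → KernelSyzygyVanishes hU f hf d p' (q + 1)) :
    KernelSyzygyVanishes hV g hg d p q := by
  rw [subsingleton_koszulHomology_iff] at hvan
  cases p with
  | zero =>
    exact KernelKoszulExact.zero (pieceMap_gradedMul hU hV f hf _ _ _ _)
      (pieceMap_comp_eq_zero hf hg h _) (exact_pieceMap hU hV hf hg h _) hvan
  | succ p =>
    have hk : KernelKoszulExact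
        (gradedMul hU d (q • d) ((q + 1) • d) (by module))
        (gradedMul hU d ((q + 1) • d) ((q + 1 + 1) • d) (by module))
        (pieceMap f hf (q • d)) (pieceMap f hf ((q + 1) • d)) p := by
      have key := hker p rfl
      unfold KernelSyzygyVanishes at key
      -- The pieces of degree `(q + 1 - 1) • d` and `q • d` are different types; a variable `e` in
      -- place of `q + 1 - 1` allows substitution.
      have hq : ∀ e (he : e = q) (h₁ : d + e • d = (q + 1) • d),
          KernelKoszulExact (gradedMul hU d (e • d) ((q + 1) • d) h₁)
            (gradedMul hU d ((q + 1) • d) ((q + 1 + 1) • d) (by module))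
            (pieceMap f hf (e • d)) (pieceMap f hf ((q + 1) • d)) p →
          KernelKoszulExact (gradedMul hU d (q • d) ((q + 1) • d) (by module))
            (gradedMul hU d ((q + 1) • d) ((q + 1 + 1) • d) (by module))
            (pieceMap f hf (q • d)) (pieceMap f hf ((q + 1) • d)) p := by
        rintro e rfl _ H
        exact H
      exact hq _ (add_sub_cancel_right q 1) _ key
    exact KernelKoszulExact.succ (gradedMul_comm hU _ _ _ _ _ _)
      (pieceMap_gradedMul hU hV f hf _ _ _ _) (pieceMap_gradedMul hU hV f hf _ _ _ _)
      (pieceMap_comp_eq_zero hf hg h _) (exact_pieceMap hU hV hf hg h _) hvan hk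

/-- The module is the kernel of its zero endomorphism, so `M` itself falls under the same inductive
step as the syzygy modules. -/
theorem subsingleton_syzygy_of_kernelSyzygyVanishes_zero (hV : IsMultigrading r 𝒱)
    (d : Fin n → ℤ) (p : ℕ) (q : ℤ)
    (h : KernelSyzygyVanishes hV (0 : V →ₗ[CoordRing K r] V)
      (fun a _ _ => (𝒱 a).zero_mem) d p q) :
    Subsingleton (Syzygy hV d p q) := by
  rw [subsingleton_koszulHomology_iff]
  intro y hy
  obtain ⟨z, -, hz⟩ := h y hy (by
    rw [show pieceMap (0 : V →ₗ[CoordRing K r] V) (fun a _ _ => (𝒱 a).zero_mem) (q • d) = 0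
      from rfl, LinearMap.rTensor_zero, LinearMap.zero_apply])
  exact ⟨z, hz⟩

end Graded

/-! ### Graded free modules -/

section Free

variable {K : Type*} [Field K] {n : ℕ} {r : Fin n → ℕ}

theorem mem_freePiece {B : Finset (Fin n → ℤ)} {f : (Fin n → ℤ) → ℕ} {a : Fin n → ℤ}
    {x : FreeMod K r B f} :
    x ∈ freePiece K r B f a ↔ ∀ k, x k ∈ shift (ringPiece K r) (k.1 : Fin n → ℤ) a := by
  simp [freePiece, Submodule.mem_pi]

open Classical in
theorem single_mem_freePiece {B : Finset (Fin n → ℤ)} {f : (Fin n → ℤ) → ℕ} {a : Fin n → ℤ}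
    (k : Σ b : B, Fin (f b)) {s : CoordRing K r}
    (hs : s ∈ shift (ringPiece K r) (k.1 : Fin n → ℤ) a) :
    (Pi.single k s : FreeMod K r B f) ∈ freePiece K r B f a := by
  rw [mem_freePiece]
  intro l
  by_cases hl : l = k
  · subst hl
    simpa using hs
  · rw [Pi.single_eq_of_ne hl]
    exact Submodule.zero_mem _

theorem isMultigrading_freePiece (B : Finset (Fin n → ℤ)) (f : (Fin n → ℤ) → ℕ) :
    IsMultigrading r (freePiece K r B f) where
  isInternal := by
    classical
    refine (DirectSum.isInternal_submodule_iff_iSupIndep_and_iSup_eq_top _).2 ⟨?_, ?_⟩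
    · intro a
      rw [Submodule.disjoint_def]
      intro x hx hx'
      funext k
      refine Submodule.disjoint_def.1
        (((isMultigrading_ringPiece K r).shift (k.1 : Fin n → ℤ)).iSupIndep a) _
        (mem_freePiece.1 hx k) ?_
      have hle : (⨆ (c) (_ : c ≠ a), freePiece K r B f c) ≤
          (⨆ (c) (_ : c ≠ a), shift (ringPiece K r) (k.1 : Fin n → ℤ) c).comap
            (LinearMap.proj k) :=
        iSup₂_le fun c hc y hy => Submodule.mem_iSup_of_mem c
          (Submodule.mem_iSup_of_mem hc (mem_freePiece.1 hy k))
      exact hle hx'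
    · rw [eq_top_iff]
      intro x _
      rw [← Finset.univ_sum_single x]
      refine sum_mem fun k _ => ?_
      have hle : (⨆ a, shift (ringPiece K r) (k.1 : Fin n → ℤ) a) ≤
          (⨆ a, freePiece K r B f a).comap (LinearMap.single K _ k) :=
        iSup_le fun a s hs => Submodule.mem_iSup_of_mem a (single_mem_freePiece k hs)
      exact hle (by
        rw [((isMultigrading_ringPiece K r).shift (k.1 : Fin n → ℤ)).iSup_eq_top]; trivial)
  smul_mem := by
    intro a c s x hs hx
    rw [mem_freePiece] at hx ⊢
    exact fun k => ((isMultigrading_ringPiece K r).shift (k.1 : Fin n → ℤ)).smul_mem a c s _ hs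
      (hx k)

/-- Coordinate projections and inclusions are graded, so the Koszul complex splits into those of the
`S(b)`. -/
theorem subsingleton_syzygy_freePiece (B : Finset (Fin n → ℤ)) (f : (Fin n → ℤ) → ℕ)
    (d : Fin n → ℤ) (p : ℕ) (q : ℤ)
    (h : ∀ b ∈ B, Subsingleton (SyzygyFunctor K d p q b r)) :
    Subsingleton (Syzygy (isMultigrading_freePiece (K := K) (r := r) B f) d p q) := by
  classical
  rw [subsingleton_koszulHomology_iff]
  have hproj : ∀ (k : Σ b : B, Fin (f b)) (a : Fin n → ℤ), ∀ x ∈ freePiece K r B f a,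
      (LinearMap.proj k : FreeMod K r B f →ₗ[CoordRing K r] CoordRing K r) x ∈
        shift (ringPiece K r) (k.1 : Fin n → ℤ) a :=
    fun k a x hx => mem_freePiece.1 hx k
  have hsingle : ∀ (k : Σ b : B, Fin (f b)) (a : Fin n → ℤ),
      ∀ x ∈ shift (ringPiece K r) (k.1 : Fin n → ℤ) a,
      (LinearMap.single (CoordRing K r) (fun _ => CoordRing K r) k) x ∈ freePiece K r B f a :=
    fun k a x hx => single_mem_freePiece k hx
  refine koszulCycles_le_range_of_sum
    (hj := fun k => pieceMap_gradedMul ((isMultigrading_ringPiece K r).shift _)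
      (isMultigrading_freePiece B f) _ (hsingle k) _ _ _ _)
    (hπ := fun k => pieceMap_gradedMul (isMultigrading_freePiece B f)
      ((isMultigrading_ringPiece K r).shift _) _ (hproj k) _ _ _ _) ?_ p
    (fun k => (subsingleton_koszulHomology_iff _ _ _).1 (h k.1 k.1.2))
  ext1 x
  apply Subtype.ext
  simpa [LinearMap.sum_apply] using Finset.univ_sum_single (x : FreeMod K r B f)

end Free

/-! ### Syzygies of a module with a free resolution -/

section Resolution

variable {K : Type*} [Field K] {n : ℕ} {r : Fin n → ℕ}
  {M : Type*} [AddCommGroup M] [Module K M] [Module (CoordRing K r) M]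
  {ℳ : (Fin n → ℤ) → Submodule K M}

/-- The vanishing of `K^d_{p,q}(E_i)`. -/
def FreeResolution.TermSyzygyVanishes (E : FreeResolution r ℳ) (d : Fin n → ℤ) (i p : ℕ)
    (q : ℤ) : Prop :=
  Subsingleton (Syzygy (isMultigrading_freePiece (K := K) (r := r) (E.twists i) (E.rank i)) d p q)

/-- The kernel of `E_{i+1} → E_i` is covered by `E_{i+2}`, whence the offset in `i + 2 + j`. Each
step lowers `p` and raises `q` and the index by one, so the induction is on `p`, not on the length.
-/
theorem FreeResolution.kernelSyzygyVanishes_diff (E : FreeResolution r ℳ) (d : Fin n → ℤ)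
    (p i : ℕ) (q : ℤ)
    (h : ∀ j p' : ℕ, p = p' + j → E.TermSyzygyVanishes d (i + 2 + j) p' (q + j)) :
    KernelSyzygyVanishes (isMultigrading_freePiece (E.twists (i + 1)) (E.rank (i + 1)))
      (E.diff i) (E.diff_mem i) d p q := by
  induction p generalizing i q with
  | zero =>
    refine kernelSyzygyVanishes_of_exact (isMultigrading_freePiece _ _) _
      (E.diff_mem (i + 1)) (E.diff_mem i) (E.exact_succ i) d 0 q ?_ (by simp)
    simpa [TermSyzygyVanishes] using h 0 0 rfl
  | succ p ih =>
    refine kernelSyzygyVanishes_of_exact (isMultigrading_freePiece _ _) _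
      (E.diff_mem (i + 1)) (E.diff_mem i) (E.exact_succ i) d (p + 1) q ?_ ?_
    · simpa [TermSyzygyVanishes] using h 0 (p + 1) rfl
    · rintro p' hp'
      obtain rfl : p = p' := by omega
      refine ih (i + 1) (q + 1) fun j p' hj => ?_
      have := h (j + 1) p' (by omega)
      rwa [show i + 2 + (j + 1) = i + 1 + 2 + j by ring,
        show q + ((j + 1 : ℕ) : ℤ) = q + 1 + j by push_cast; ring] at this

/-- The shifting may run past the length of the resolution, but there are no twists there, so the
minimum covers every twist that occurs. -/
theorem FreeResolution.minBound_le {E : FreeResolution r ℳ}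
    (P : ℤ → (Fin n → ℤ) → (Fin n → ℤ) → ℝ) (q : ℤ) (d : Fin n → ℤ) {i : ℕ} {b : Fin n → ℤ}
    (hb : b ∈ E.twists i) : E.minBound P q d ≤ ((P (q + i) b d + i : ℝ) : WithTop ℝ) := by
  have hi : i ∈ Finset.range (E.length + 1) := by
    by_contra hi
    rw [E.twists_eq_empty i (by simpa using hi)] at hb
    simp at hb
  exact (Finset.inf_le hi).trans
    (Finset.inf_le (f := fun b => ((P (q + i) b d + i : ℝ) : WithTop ℝ)) hb)

variable [IsScalarTower K (CoordRing K r) M]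

theorem FreeResolution.kernelSyzygyVanishes_aug
    (E : FreeResolution r ℳ) (d : Fin n → ℤ) (p : ℕ) (q : ℤ)
    (h : ∀ j p' : ℕ, p = p' + j → E.TermSyzygyVanishes d (1 + j) p' (q + j)) :
    KernelSyzygyVanishes (isMultigrading_freePiece (E.twists 0) (E.rank 0))
      E.aug E.aug_mem d p q := by
  refine kernelSyzygyVanishes_of_exact (isMultigrading_freePiece _ _) _
    (E.diff_mem 0) E.aug_mem E.exact_zero d p q (by simpa [TermSyzygyVanishes] using h 0 p rfl) ?_
  rintro p' rfl
  refine E.kernelSyzygyVanishes_diff d p' 0 (q + 1) fun j p'' hj => ?_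
  have := h (j + 1) p'' (by omega)
  rwa [show 1 + (j + 1) = 0 + 2 + j by ring,
    show q + ((j + 1 : ℕ) : ℤ) = q + 1 + j by push_cast; ring] at this

theorem FreeResolution.subsingleton_syzygy (hM : IsMultigrading r ℳ)
    (E : FreeResolution r ℳ) (d : Fin n → ℤ) (p : ℕ) (q : ℤ)
    (h : ∀ j p' : ℕ, p = p' + j → E.TermSyzygyVanishes d j p' (q + j)) :
    Subsingleton (Syzygy hM d p q) := by
  apply subsingleton_syzygy_of_kernelSyzygyVanishes_zero
  refine kernelSyzygyVanishes_of_exact (isMultigrading_freePiece _ _) hM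
    E.aug_mem _ ?_ d p q (by simpa [TermSyzygyVanishes] using h 0 p rfl) ?_
  -- Exactness of `E₀ → M → M` with second map zero is the surjectivity of the augmentation.
  · rw [LinearMap.range_eq_top.2 E.aug_surjective, LinearMap.ker_zero]
  rintro p' rfl
  refine E.kernelSyzygyVanishes_aug d p' (q + 1) fun j p'' hj => ?_
  have := h (j + 1) p'' (by omega)
  rwa [add_comm j 1, show q + ((1 + j : ℕ) : ℤ) = q + 1 + j by push_cast; ring] at this

end Resolution

end SegreVeronese

end

theorem theoremA1 {K : Type*} [Field K] {n : ℕ}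
    (P : ℤ → (Fin n → ℤ) → (Fin n → ℤ) → ℝ) (hP : SegreVeronese.IsVanishingBound K P)
    (r : Fin n → ℕ) {M : Type*} [AddCommGroup M] [Module K M]
    [Module (SegreVeronese.CoordRing K r) M] [IsScalarTower K (SegreVeronese.CoordRing K r) M]
    [Module.Finite (SegreVeronese.CoordRing K r) M]
    (ℳ : (Fin n → ℤ) → Submodule K M) (hM : SegreVeronese.IsMultigrading r ℳ)
    (E : SegreVeronese.FreeResolution r ℳ) (hE : E.IsMinimal)
    (q : ℤ) (hq : 2 ≤ q) (d : Fin n → ℤ) (hd : ∀ i, 0 < d i)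
    (p : ℕ) (hp : ((p : ℝ) : WithTop ℝ) ≤ E.minBound P q d) :
    Subsingleton (SegreVeronese.Syzygy hM d p q) := by
  refine E.subsingleton_syzygy hM d p q fun j p' hj => ?_
  refine SegreVeronese.subsingleton_syzygy_freePiece _ _ d p' (q + j) fun b hb => ?_
  refine hP (q + j) (by omega) b d hd p' ?_ r
  -- Here `p = p' + j`, so the summand `j` in the minimum cancels and leaves `p' ≤ P_{q+j,b}(d)`.
  have hle := WithTop.coe_le_coe.1 (hp.trans (SegreVeronese.FreeResolution.minBound_le P q d hb))
  rw [hj] at hle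
  push_cast at hle
  linarith
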